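/- Let $G$ be a finite simple connected graph with vertex set $V$ and edge set $E$, and let $d(x,y)$ be the distance between $x$ and $y$ in $G$. Its Wiener index is $W(G)=\sum_{\{x,y\}\subseteq V}d(x,y)$, and its Szeged index is $Sz(G)=\sum_{e=xy\in E}n_x(e)\,n_y(e)$, where for an edge $e=xy$ the number of vertices $w\in V$ with $d(x,w)<d(y,w)$ is denoted by $n_x(e)$ and the number of vertices $w\in V$ with $d(y,w)<d(x,w)$ by $n_y(e)$. Theorem. Let $n\ge 4$. If $G$ is a connected bipartite graph with $n$ vertices and $m\ge n$ edges, then $$Sz(G)-W(G)\ \ge\ 4n-8.$$ Moreover, the bound is best possible for every $n\ge 4$: for every tree $T$ on $n-3$ vertices and every vertex $r$ of $T$, there is a graph composed of a cycle $C_4$ on $4$ vertices and (a copy of) $T$ sharing a single vertex, namely $r$ (that is, a graph which is the union of a subgraph isomorphic to $C_4$ and a subgraph isomorphic to $T$ whose only common vertex is $r$); and every such graph $G$ is connected and bipartite, has $n$ vertices and at least $n$ edges, and satisfies $Sz(G)-W(G)=4n-8$. -/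

import Mathlib

universe u v

open Classical in
/-- The Wiener index: the sum of the distances over all unordered pairs of vertices. The sum runs
over `Sym2 V`; the degenerate pairs `s(v, v)` contribute `G.dist v v = 0`. -/
noncomputable def wienerIndex {V : Type u} [Fintype V] (G : SimpleGraph V) : ℕ :=
  ∑ p : Sym2 V, Sym2.lift ⟨fun x y => G.dist x y, fun _ _ => G.dist_comm⟩ p

/-- The number of vertices of `G` that are strictly closer to `x` than to `y`; for an edge `e = xy`
this is `n_x(e)`. -/
noncomputable def closerCount {V : Type u} [Fintype V] (G : SimpleGraph V) (x y : V) : ℕ :=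
  (Finset.univ.filter fun w : V => G.dist x w < G.dist y w).card

open Classical in
/-- The Szeged index: the sum over all edges `e = xy` of `n_x(e) * n_y(e)`. -/
noncomputable def szegedIndex {V : Type u} [Fintype V] (G : SimpleGraph V) : ℕ :=
  ∑ e ∈ G.edgeFinset,
    Sym2.lift ⟨fun x y => closerCount G x y * closerCount G y x, fun _ _ => Nat.mul_comm _ _⟩ e

/-- `G` is composed of a 4-cycle and a copy of `T` that share exactly one vertex, namely the copy
of the vertex `r` of `T`: `G` is the union of two subgraphs `C` and `B`, where `C` is isomorphic to
the cycle on four vertices, `B` is isomorphic to `T`, and the only common vertex of `C` and `B` is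
the image of `r`. -/
def IsC4SharingVertexWith {V : Type u} {U : Type v} (G : SimpleGraph V) (T : SimpleGraph U)
    (r : U) : Prop :=
  ∃ (C B : G.Subgraph) (φ : T ≃g B.coe),
    Nonempty (SimpleGraph.cycleGraph 4 ≃g C.coe) ∧ C ⊔ B = ⊤ ∧ C.verts ∩ B.verts = {(φ r : V)}

/-!
Why the theorem is true. Say that an oriented edge `(a, b)` separates `x` from `y` if `x` is closer
to `a` and `y` is closer to `b`. Exchanging the order of summation, twice the Szeged index is the
number of separating oriented edges, summed over all ordered pairs `(x, y)`. A geodesic from `x` to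
`y` consists of `d(x, y)` separating edges, so twice the difference of the two indices is the sum
over all ordered pairs of the nonnegative *excess*, the number of separating edges minus the
distance (`two_mul_szegedIndex_eq`).

*The inequality.* A connected bipartite graph with at least as many edges as vertices contains an
isometric even cycle of some length `2k ≥ 4` (`exists_isometric_cycle`): take two geodesics with
common ends, the last steps of which differ, of least possible length `k`. For any vertex `x`, each
of the `2k` edges of the cycle separates `x` from exactly one of any two antipodal vertices of the
cycle. If `m` is the distance of `x` from the cycle, geodesics supply `m` further separating edges,
nearer to `x`, for each of the two vertices. As the distances from `x` to the two vertices add up to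
at most `2m + k`, their excesses add up to at least `k` (`le_excess_add_excess`). So the excess
between `x` and the vertices of the cycle is at least `k²` in total, and summing over all `x` gives
`2 (Sz - W) ≥ n k² + (n - 2k) k²`, which is at least `8n - 16` as `n ≥ 2k`.

*Equality.* A 4-cycle and a tree `T` with a common vertex embed isometrically into the Cartesian
product of the 4-cycle and `T` (`C4Gluing.dist_eq`). The separating edges are those of the two
projections; in the tree they are just the edges of the path, whereas in the 4-cycle they are
twice as many as the distance. So the excess of a pair is the distance of its projections to the
4-cycle (`C4Gluing.excess_eq`), and these distances are summed directly.
-/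

section

open Finset

variable {V : Type u} {G : SimpleGraph V}

/-! ### Separating edges and the excess of a pair -/

open Classical in
/-- The oriented edges of `G` that separate `x` from `y`: the pairs `(a, b)` of adjacent vertices
such that `x` is strictly closer to `a` and `y` is strictly closer to `b`. -/
noncomputable def sepDarts [Fintype V] (G : SimpleGraph V) (x y : V) : Finset (V × V) :=
  univ.filter fun e : V × V =>
    G.Adj e.1 e.2 ∧ G.dist e.1 x < G.dist e.2 x ∧ G.dist e.2 y < G.dist e.1 y

theorem mem_sepDarts [Fintype V] {x y : V} {e : V × V} :
    e ∈ sepDarts G x y ↔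
      G.Adj e.1 e.2 ∧ G.dist e.1 x < G.dist e.2 x ∧ G.dist e.2 y < G.dist e.1 y := by
  simp [sepDarts]

theorem card_sepDarts_comm [Fintype V] (x y : V) :
    (sepDarts G x y).card = (sepDarts G y x).card := by
  refine Finset.card_bij' (fun e _ => e.swap) (fun e _ => e.swap) ?_ ?_ ?_ ?_
  · intro e he
    rw [mem_sepDarts] at he ⊢
    exact ⟨he.1.symm, he.2.2, he.2.1⟩
  · intro e he
    rw [mem_sepDarts] at he ⊢
    exact ⟨he.1.symm, he.2.2, he.2.1⟩
  · simp
  · simp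

open Classical in
/-- A sum over ordered pairs of adjacent vertices counts every edge twice. -/
theorem two_mul_sum_edgeFinset [Fintype V] (H : SimpleGraph V) [Fintype H.edgeSet]
    (f : Sym2 V → ℕ) :
    2 * ∑ e ∈ H.edgeFinset, f e = ∑ x, ∑ y, if H.Adj x y then f s(x, y) else 0 := by
  have h1 : ∑ d : H.Dart, f d.edge = ∑ e ∈ H.edgeFinset, 2 * f e := by
    rw [← Finset.sum_fiberwise_of_maps_to (s := univ) (t := H.edgeFinset)
      (g := fun d : H.Dart => d.edge) (fun d _ => by simp)]
    refine Finset.sum_congr rfl fun e he => ?_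
    rw [Finset.sum_congr rfl (g := fun _ => f e) (fun d hd => by rw [(mem_filter.1 hd).2]),
      Finset.sum_const, H.dart_edge_fiber_card e (by simpa using he), smul_eq_mul]
  rw [Finset.mul_sum, ← h1, ← Fintype.sum_prod_type', ← Finset.sum_filter]
  refine Finset.sum_bij' (fun d _ => d.toProd) (fun p hp => ⟨p, (mem_filter.1 hp).2⟩) ?_ ?_ ?_ ?_ ?_
  · intro d _
    simp
  · simp
  · simp
  · simp
  · intro d _
    rfl

theorem two_mul_wienerIndex [Fintype V] (G : SimpleGraph V) :
    2 * wienerIndex G = ∑ x, ∑ y, G.dist x y := by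
  classical
  have h : wienerIndex G = ∑ e ∈ (⊤ : SimpleGraph V).edgeFinset,
      Sym2.lift ⟨fun x y => G.dist x y, fun _ _ => G.dist_comm⟩ e := by
    unfold wienerIndex
    symm
    refine Finset.sum_subset (subset_univ _) ?_
    intro e _ he
    induction e with
    | h x y =>
      have : x = y := by simpa using he
      simp [this]
  rw [h, two_mul_sum_edgeFinset]
  refine Finset.sum_congr rfl fun x _ => Finset.sum_congr rfl fun y _ => ?_
  by_cases hxy : x = y
  · simp [hxy]
  · simp [hxy]

theorem two_mul_szegedIndex [Fintype V] (G : SimpleGraph V) :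
    2 * szegedIndex G = ∑ x, ∑ y, (sepDarts G x y).card := by
  classical
  unfold szegedIndex
  rw [two_mul_sum_edgeFinset]
  have h : ∀ a b, (if G.Adj a b then Sym2.lift ⟨fun x y => closerCount G x y * closerCount G y x,
      fun _ _ => Nat.mul_comm _ _⟩ s(a, b) else 0) =
      ∑ x, ∑ y, if G.Adj a b ∧ G.dist a x < G.dist b x ∧ G.dist b y < G.dist a y then 1 else 0 := by
    intro a b
    by_cases hab : G.Adj a b
    · simp only [hab, if_true, Sym2.lift_mk, closerCount, true_and, Finset.card_filter,
        Finset.sum_mul_sum]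
      refine Finset.sum_congr rfl fun x _ => Finset.sum_congr rfl fun y _ => ?_
      by_cases h1 : G.dist a x < G.dist b x <;> by_cases h2 : G.dist b y < G.dist a y <;>
        simp [h1, h2]
    · simp [hab]
  simp only [h, sepDarts, Finset.card_filter, Fintype.sum_prod_type]
  calc _ = ∑ a, ∑ x, ∑ b, ∑ y, _ := Finset.sum_congr rfl fun a _ => Finset.sum_comm
    _ = ∑ x, ∑ a, ∑ b, ∑ y, _ := Finset.sum_comm
    _ = ∑ x, ∑ a, ∑ y, ∑ b, _ :=
      Finset.sum_congr rfl fun x _ => Finset.sum_congr rfl fun a _ => Finset.sum_comm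
    _ = _ := Finset.sum_congr rfl fun x _ => Finset.sum_comm

/-- Every level `i < d(x, y)` of a geodesic from `x` to `y` contributes a separating edge. -/
theorem exists_mem_sepDarts [Fintype V] (hG : G.Connected) {x y : V} {i : ℕ}
    (hi : i < G.dist x y) :
    ∃ e ∈ sepDarts G x y, G.dist e.1 x = i ∧ G.dist e.2 x = i + 1 := by
  obtain ⟨p, hp⟩ := hG.exists_walk_length_eq_dist x y
  have hlt : i < p.length := hp ▸ hi
  have hadj := p.adj_getVert_succ hlt
  have h1 : G.dist x (p.getVert i) ≤ i := by
    have := G.dist_le (p.take i)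
    simp at this
    omega
  have h2 : G.dist (p.getVert (i + 1)) y ≤ G.dist x y - (i + 1) := by
    have := G.dist_le (p.drop (i + 1))
    simpa [hp] using this
  have h3 := hG.dist_triangle (u := x) (v := p.getVert i) (w := p.getVert (i + 1))
  have h4 := hG.dist_triangle (u := p.getVert i) (v := p.getVert (i + 1)) (w := y)
  have h5 := hG.dist_triangle (u := x) (v := p.getVert (i + 1)) (w := y)
  have h6 := hG.dist_triangle (u := x) (v := p.getVert i) (w := y)
  have h7 : G.dist (p.getVert i) (p.getVert (i + 1)) = 1 := SimpleGraph.dist_eq_one_iff_adj.2 hadj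
  refine ⟨(p.getVert i, p.getVert (i + 1)), mem_sepDarts.2 ⟨hadj, ?_, ?_⟩, ?_, ?_⟩ <;>
    simp only [G.dist_comm (v := x)] <;> omega

/-- If the separating edges in `s` all start at distance at least `m` from `x`, then the first `m`
edges of a geodesic from `x` to `y` are separating edges outside `s`. -/
theorem add_card_le_card_sepDarts [Fintype V] (hG : G.Connected) {x y : V} {m : ℕ}
    (hm : m ≤ G.dist x y) {s : Finset (V × V)} (hs : s ⊆ sepDarts G x y)
    (hms : ∀ e ∈ s, m ≤ G.dist e.1 x) : m + s.card ≤ (sepDarts G x y).card := by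
  classical
  have : Nonempty (V × V) := ⟨(x, y)⟩
  choose! f hf hf1 hf2 using fun i (hi : i < m) => exists_mem_sepDarts hG (hi.trans_le hm)
  have hinj : Set.InjOn f (range m : Set ℕ) := by
    intro i hi j hj hij
    have hi' : i < m := by simpa using hi
    have hj' : j < m := by simpa using hj
    rw [← hf1 i hi', ← hf1 j hj', hij]
  have hdisj : Disjoint ((range m).image f) s := by
    rw [Finset.disjoint_left]
    intro e he hes
    obtain ⟨i, hi, rfl⟩ := mem_image.1 he
    have hi' : i < m := by simpa using hi
    have := hms _ hes
    rw [hf1 i hi'] at this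
    omega
  calc m + s.card = ((range m).image f ∪ s).card := by
        rw [card_union_of_disjoint hdisj, card_image_of_injOn hinj, card_range]
    _ ≤ _ := card_le_card (union_subset (fun e he => by
        obtain ⟨i, hi, rfl⟩ := mem_image.1 he
        exact hf i (by simpa using hi)) hs)

theorem dist_le_card_sepDarts [Fintype V] (hG : G.Connected) (x y : V) :
    G.dist x y ≤ (sepDarts G x y).card := by
  simpa using add_card_le_card_sepDarts hG le_rfl (empty_subset _) (by simp)

/-- In a connected bipartite graph no edge has both ends at the same distance from a vertex. -/
theorem SimpleGraph.IsBipartite.dist_ne_of_adj (hb : G.IsBipartite) (hG : G.Connected) {a b : V}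
    (hab : G.Adj a b) (x : V) : G.dist a x ≠ G.dist b x := by
  obtain ⟨c⟩ := hb
  let c' : G.Coloring Bool := G.recolorOfEquiv finTwoEquiv c
  obtain ⟨p, hp⟩ := hG.exists_walk_length_eq_dist a x
  obtain ⟨q, hq⟩ := hG.exists_walk_length_eq_dist b x
  intro h
  have h1 := c'.even_length_iff_congr p
  have h2 := c'.even_length_iff_congr q
  have h3 := c'.valid hab
  rw [hp, h, ← hq, h2] at h1
  revert h1 h3
  cases c' a <;> cases c' b <;> cases c' x <;> simp

theorem SimpleGraph.IsBipartite.dist_add_one_eq_or (hb : G.IsBipartite) (hG : G.Connected) {a b : V}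
    (hab : G.Adj a b) (x : V) :
    G.dist a x + 1 = G.dist b x ∨ G.dist b x + 1 = G.dist a x := by
  have h := hb.dist_ne_of_adj hG hab x
  have h1 := hG.dist_triangle (u := a) (v := b) (w := x)
  have h2 := hG.dist_triangle (u := b) (v := a) (w := x)
  have h3 : G.dist a b = 1 := SimpleGraph.dist_eq_one_iff_adj.2 hab
  have h4 : G.dist b a = 1 := SimpleGraph.dist_eq_one_iff_adj.2 hab.symm
  omega

/-- The number of oriented edges separating `x` from `y` in excess of the distance of `x` and `y`.
In a connected graph the truncated subtraction is exact, by `dist_le_card_sepDarts`. -/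
noncomputable def excess [Fintype V] (G : SimpleGraph V) (x y : V) : ℕ :=
  (sepDarts G x y).card - G.dist x y

theorem excess_comm [Fintype V] (x y : V) : excess G x y = excess G y x := by
  rw [excess, excess, card_sepDarts_comm, G.dist_comm]

/-- The difference of the Szeged and the Wiener index is the total excess over all unordered
pairs. -/
theorem two_mul_szegedIndex_eq [Fintype V] (hG : G.Connected) :
    2 * szegedIndex G = 2 * wienerIndex G + ∑ x, ∑ y, excess G x y := by
  rw [two_mul_szegedIndex, two_mul_wienerIndex, ← Finset.sum_add_distrib]
  refine Finset.sum_congr rfl fun x _ => ?_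
  rw [← Finset.sum_add_distrib]
  refine Finset.sum_congr rfl fun y _ => ?_
  have := dist_le_card_sepDarts hG x y
  unfold excess
  omega

/-! ### Isometric even cycles in bipartite graphs -/

/-- A geodesic from `a` to `b` with last step from `u` to `b`, as a sequence of vertices. -/
theorem exists_geodesic (hG : G.Connected) {a u b : V} (hub : G.Adj u b)
    (hd : G.dist a u + 1 = G.dist a b) :
    ∃ p : ℕ → V, p 0 = a ∧ p (G.dist a u) = u ∧ p (G.dist a b) = b ∧
      ∀ i j, i ≤ j → j ≤ G.dist a b → G.dist (p i) (p j) = j - i := by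
  obtain ⟨w, hw⟩ := hG.exists_walk_length_eq_dist a u
  have hlen : (w.concat hub).length = G.dist a b := by simp [hw, hd]
  have hstep : ∀ i j, i ≤ j → G.dist ((w.concat hub).getVert i) ((w.concat hub).getVert j) ≤
      j - i := by
    intro i j hij
    have h1 := G.dist_le (((w.concat hub).drop i).take (j - i))
    simp only [SimpleGraph.Walk.drop_getVert, Nat.add_sub_cancel' hij] at h1
    refine h1.trans ?_
    simp
  refine ⟨(w.concat hub).getVert, by simp, ?_, ?_, ?_⟩
  · rw [SimpleGraph.Walk.concat_eq_append, ← hw, SimpleGraph.Walk.getVert_append]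
    simp
  · rw [← hlen, SimpleGraph.Walk.getVert_length]
  · intro i j hij hj
    refine le_antisymm (hstep i j hij) ?_
    have h1 := hstep 0 i (Nat.zero_le _)
    have h2 := hstep j (G.dist a b) hj
    have h0 : (w.concat hub).getVert 0 = a := by simp
    have hk : (w.concat hub).getVert (G.dist a b) = b := by
      rw [← hlen, SimpleGraph.Walk.getVert_length]
    rw [h0] at h1
    rw [hk] at h2
    have h3 := hG.dist_triangle (u := a) (v := (w.concat hub).getVert i) (w := b)
    have h4 := hG.dist_triangle (u := (w.concat hub).getVert i) (v := (w.concat hub).getVert j)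
      (w := b)
    omega

/-- There are two vertices at distance `l` of which the second has two different neighbours
closer to the first. -/
def HasTwoGeodesics (G : SimpleGraph V) (l : ℕ) : Prop :=
  ∃ a b u w, G.dist a b = l ∧ u ≠ w ∧ G.Adj u b ∧ G.Adj w b ∧ G.dist a u + 1 = l ∧
    G.dist a w + 1 = l

/-- If every vertex had at most one neighbour closer to a root, then mapping every edge to its far
end would be an injection into the vertices other than the root. -/
theorem exists_hasTwoGeodesics [Fintype V] (hG : G.Connected) (hb : G.IsBipartite)
    (hm : Fintype.card V ≤ G.edgeSet.ncard) : ∃ l, HasTwoGeodesics G l := by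
  classical
  obtain ⟨a⟩ := hG.nonempty
  by_contra hno
  have huniq : ∀ b u w, G.Adj u b → G.Adj w b → G.dist a u < G.dist a b →
      G.dist a w < G.dist a b → u = w := by
    intro b u w hu hw hu' hw'
    by_contra huw
    refine hno ⟨G.dist a b, a, b, u, w, rfl, huw, hu, hw, ?_, ?_⟩
    · have := hb.dist_add_one_eq_or hG hu a
      simp only [G.dist_comm (v := a)] at this
      omega
    · have := hb.dist_add_one_eq_or hG hw a
      simp only [G.dist_comm (v := a)] at this
      omega
  have hfar : ∀ e ∈ G.edgeSet, ∃ p : V × V, e = s(p.1, p.2) ∧ G.dist a p.1 < G.dist a p.2 := by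
    intro e he
    induction e with
    | h x y =>
      have := hb.dist_add_one_eq_or hG (G.mem_edgeSet.1 he) a
      simp only [G.dist_comm (v := a)] at this
      rcases this with h | h
      · exact ⟨(x, y), rfl, by simp; omega⟩
      · exact ⟨(y, x), Sym2.eq_swap, by simp; omega⟩
  have : Nonempty (V × V) := ⟨(a, a)⟩
  choose! f hf hlt using hfar
  have hcard : G.edgeSet.ncard ≤ ({a}ᶜ : Set V).ncard := by
    refine Set.ncard_le_ncard_of_injOn (fun e => (f e).2) ?_ ?_ (Set.toFinite _)
    · intro e he
      have := hlt e he
      simp only [Set.mem_compl_iff, Set.mem_singleton_iff]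
      intro h
      simp [h] at this
    · intro e he e' he' hee
      have hee : (f e).2 = (f e').2 := hee
      have h1 : G.Adj (f e).1 (f e).2 := by
        rw [← G.mem_edgeSet, ← hf e he]; exact he
      have h2 : G.Adj (f e').1 (f e').2 := by
        rw [← G.mem_edgeSet, ← hf e' he']; exact he'
      have h3 := hlt e he
      have h4 := hlt e' he'
      rw [hf e he, hf e' he', hee]
      rw [hee] at h1 h3
      rw [huniq _ _ _ h1 h2 h3 h4]
  have hc : ({a}ᶜ : Set V).ncard + 1 = Fintype.card V := by
    have := Set.ncard_add_ncard_compl ({a} : Set V)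
    rw [Set.ncard_singleton, Nat.card_eq_fintype_card] at this
    omega
  omega

/-- Two geodesics that leave their common start through different vertices stay as far apart as
possible, as long as the distances in question are below the least length of a pair of geodesics
with common ends. -/
theorem dist_of_diverging_geodesics (hG : G.Connected) (hb : G.IsBipartite) {k : ℕ} {p q : ℕ → V}
    (hmin : ∀ l < k, ¬ HasTwoGeodesics G l)
    (hp : ∀ i j, i ≤ j → j ≤ k → G.dist (p i) (p j) = j - i)
    (hq : ∀ i j, i ≤ j → j ≤ k → G.dist (q i) (q j) = j - i)
    (h0 : p 0 = q 0) (h1 : p 1 ≠ q 1) (i j : ℕ) (hij : i + j ≤ k) :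
    G.dist (p i) (q j) = i + j := by
  induction j using Nat.strong_induction_on with
  | _ j ih =>
    rcases j with _ | j
    · rw [← h0, G.dist_comm, hp 0 i (by omega) (by omega)]
      omega
    rcases Nat.eq_zero_or_pos i with rfl | hi
    · rw [h0, hq 0 (j + 1) (by omega) (by omega)]
      omega
    have hj := ih j (by omega) (by omega)
    have hadj : G.Adj (q (j + 1)) (q j) := by
      rw [← SimpleGraph.dist_eq_one_iff_adj, G.dist_comm, hq j (j + 1) (by omega) (by omega)]
      omega
    have hor := hb.dist_add_one_eq_or hG hadj (p i)
    rw [G.dist_comm (u := q (j + 1)), G.dist_comm (u := q j), hj] at hor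
    rcases hor with h | h
    -- otherwise `q (j + 1)` and the vertex before `q j` are both closer to `p i` than `q j` is
    · exfalso
      rcases j with _ | j
      · refine hmin i (by omega) ⟨p i, q 0, p 1, q 1, by omega, h1, ?_, hadj, ?_, by omega⟩
        · rw [← SimpleGraph.dist_eq_one_iff_adj, ← h0, G.dist_comm, hp 0 1 (by omega) (by omega)]
        · rw [G.dist_comm, hp 1 i (by omega) (by omega)]
          omega
      · have hj' := ih j (by omega) (by omega)
        refine hmin (i + (j + 1)) (by omega)
          ⟨p i, q (j + 1), q j, q (j + 1 + 1), hj, ?_, ?_, hadj, by omega, h⟩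
        · intro hqq
          have := hq j (j + 1 + 1) (by omega) (by omega)
          rw [← hqq, SimpleGraph.dist_self] at this
          omega
        · rw [← SimpleGraph.dist_eq_one_iff_adj, hq j (j + 1) (by omega) (by omega)]
          omega
    · omega

/-- A connected bipartite graph that is not a tree contains an isometric cycle of even length
`2 * k`, here in the form of a closed sequence in which the distances of any vertex to two
antipodal ones add up to `k`. -/
theorem exists_isometric_cycle [Fintype V] (hG : G.Connected) (hb : G.IsBipartite)
    (hm : Fintype.card V ≤ G.edgeSet.ncard) :
    ∃ (k : ℕ) (c : ℕ → V), 2 ≤ k ∧ c (2 * k) = c 0 ∧ Set.InjOn c (range (2 * k) : Set ℕ) ∧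
      (∀ j < 2 * k, G.Adj (c j) (c (j + 1))) ∧
      ∀ j ≤ 2 * k, ∀ i < k, G.dist (c j) (c i) + G.dist (c j) (c (i + k)) = k := by
  classical
  have hex := exists_hasTwoGeodesics hG hb hm
  obtain ⟨k, hk, hmin⟩ : ∃ k, HasTwoGeodesics G k ∧ ∀ l < k, ¬ HasTwoGeodesics G l :=
    ⟨Nat.find hex, Nat.find_spec hex, fun l hl => Nat.find_min hex hl⟩
  obtain ⟨a, b, u, w, hab, huw, hub, hwb, hau, haw⟩ := hk
  obtain ⟨p, hp0, hpu, hpk, hp⟩ := exists_geodesic hG hub (hau.trans hab.symm)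
  obtain ⟨q, hq0, hqw, hqk, hq⟩ := exists_geodesic hG hwb (haw.trans hab.symm)
  rw [hab] at hpk hqk hp hq
  have hk2 : 2 ≤ k := by
    by_contra hlt
    have h1 : G.dist a u = 0 := by omega
    have h2 : G.dist a w = 0 := by omega
    rw [hG.dist_eq_zero_iff] at h1 h2
    exact huw (h1.symm.trans h2)
  have hne0 : p 1 ≠ q 1 := by
    intro h
    refine hmin (k - 1) (by omega) ⟨p 1, b, u, w, ?_, huw, hub, hwb, ?_, ?_⟩
    · rw [← hpk, hp 1 k (by omega) le_rfl]
    · rw [← hpu, hp 1 _ (by omega) (by omega)]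
      omega
    · rw [h, ← hqw, hq 1 _ (by omega) (by omega)]
      omega
  have hnek : p (k - 1) ≠ q (k - 1) := by
    have h1 : G.dist a u = k - 1 := by omega
    have h2 : G.dist a w = k - 1 := by omega
    rw [h1] at hpu
    rw [h2] at hqw
    rwa [hpu, hqw]
  have hlow := fun i j => dist_of_diverging_geodesics hG hb hmin hp hq (hp0.trans hq0.symm) hne0 i j
  -- the same for the two geodesics read from their common end `b`
  have hrev := fun i j => dist_of_diverging_geodesics hG hb hmin
    (p := fun i => p (k - i)) (q := fun i => q (k - i))
    (fun i j hij hj => by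
      rw [G.dist_comm, hp (k - j) (k - i) (by omega) (by omega)]; omega)
    (fun i j hij hj => by
      rw [G.dist_comm, hq (k - j) (k - i) (by omega) (by omega)]; omega)
    (by simp [hpk, hqk]) hnek i j
  have hhigh : ∀ i j, i ≤ k → j ≤ k → k ≤ i + j → G.dist (p i) (q j) = 2 * k - i - j := by
    intro i j hi hj hij
    have := hrev (k - i) (k - j) (by omega)
    simp only [Nat.sub_sub_self hi, Nat.sub_sub_self hj] at this
    omega
  have hpp : ∀ i j, i ≤ k → j ≤ k → G.dist (p i) (p j) = (i - j) + (j - i) := by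
    intro i j hi hj
    rcases le_total i j with h | h
    · rw [hp i j h hj]; omega
    · rw [G.dist_comm, hp j i h hi]; omega
  have hqq : ∀ i j, i ≤ k → j ≤ k → G.dist (q i) (q j) = (i - j) + (j - i) := by
    intro i j hi hj
    rcases le_total i j with h | h
    · rw [hq i j h hj]; omega
    · rw [G.dist_comm, hq j i h hi]; omega
  have hpq : ∀ i j, i ≤ k → j ≤ k → G.dist (p i) (q j) = min (i + j) (2 * k - i - j) := by
    intro i j hi hj
    rcases le_total (i + j) k with h | h
    · rw [hlow i j h]; omega
    · rw [hhigh i j hi hj h]; omega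
  -- the cycle goes from `a` to `b` along `p` and returns along `q`
  obtain ⟨c, hcp, hcq⟩ : ∃ c : ℕ → V, (∀ i ≤ k, c i = p i) ∧ ∀ i ≤ k, c (2 * k - i) = q i := by
    refine ⟨fun i => if i ≤ k then p i else q (2 * k - i), fun i hi => by simp [hi], ?_⟩
    intro i hi
    rcases hi.lt_or_eq with h | rfl
    · have h1 : ¬ 2 * k - i ≤ k := by omega
      have h2 : 2 * k - (2 * k - i) = i := by omega
      simp [h1, h2]
    · have h1 : 2 * i - i = i := by omega
      simp [h1, hpk, hqk]
  have hcases : ∀ j ≤ 2 * k, (j ≤ k ∧ c j = p j) ∨ (k < j ∧ c j = q (2 * k - j)) := by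
    intro j hj
    rcases le_or_gt j k with h | h
    · exact Or.inl ⟨h, hcp j h⟩
    · refine Or.inr ⟨h, ?_⟩
      rw [← hcq (2 * k - j) (by omega)]
      congr 1
      omega
  have hdist : ∀ i ≤ 2 * k, ∀ j ≤ 2 * k, i ≤ j →
      G.dist (c i) (c j) = min (j - i) (2 * k - (j - i)) := by
    intro i hi j hj hij
    rcases hcases i hi with ⟨h1, e1⟩ | ⟨h1, e1⟩ <;> rcases hcases j hj with ⟨h2, e2⟩ | ⟨h2, e2⟩ <;>
      rw [e1, e2]
    · rw [hpp _ _ h1 h2]; omega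
    · rw [hpq _ _ h1 (by omega)]; omega
    · omega
    · rw [hqq _ _ (by omega) (by omega)]; omega
  refine ⟨k, c, hk2, ?_, ?_, ?_, ?_⟩
  · have := hcq 0 (by omega)
    rw [Nat.sub_zero] at this
    rw [this, hq0, hcp 0 (by omega), hp0]
  · have hlt : ∀ i j, i < j → j < 2 * k → c i ≠ c j := by
      intro i j hij hj h
      have := hdist i (by omega) j (by omega) hij.le
      rw [h, SimpleGraph.dist_self] at this
      omega
    intro i hi j hj h
    simp only [coe_range, Set.mem_Iio] at hi hj
    rcases lt_trichotomy i j with h' | h' | h'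
    · exact absurd h (hlt i j h' hj)
    · exact h'
    · exact absurd h.symm (hlt j i h' hi)
  · intro j hj
    rw [← SimpleGraph.dist_eq_one_iff_adj, hdist j (by omega) (j + 1) (by omega) (by omega)]
    omega
  · intro j hj i hi
    have h1 := hdist i (by omega) j hj
    have h2 := hdist j hj i (by omega)
    have h3 := hdist (i + k) (by omega) j hj
    have h4 := hdist j hj (i + k) (by omega)
    rw [G.dist_comm] at h1 h3
    omega

/-! ### The lower bound -/

/-- Each edge of the isometric cycle separates any `x` from exactly one of two antipodal vertices
of the cycle. So these two vertices together gain `2 * k` separating edges from the cycle, besides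
the ones on the way from `x` to the cycle, while their distances from the point of the cycle
nearest to `x` add up to only `k`. -/
theorem le_excess_add_excess [Fintype V] (hG : G.Connected) (hb : G.IsBipartite) {k : ℕ}
    {c : ℕ → V} (hk : 2 ≤ k) (hc : c (2 * k) = c 0) (hinj : Set.InjOn c (range (2 * k) : Set ℕ))
    (hadj : ∀ j < 2 * k, G.Adj (c j) (c (j + 1)))
    (hanti : ∀ j ≤ 2 * k, ∀ i < k, G.dist (c j) (c i) + G.dist (c j) (c (i + k)) = k)
    (x : V) {i : ℕ} (hi : i < k) : k ≤ excess G x (c i) + excess G x (c (i + k)) := by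
  classical
  obtain ⟨i₀, hi₀, hmin⟩ := Finset.exists_min_image (range (2 * k)) (fun j => G.dist (c j) x)
    ⟨0, by simp; omega⟩
  have hi₀' : i₀ < 2 * k := by simpa using hi₀
  set m := G.dist (c i₀) x with hm
  have hmin' : ∀ j ≤ 2 * k, m ≤ G.dist (c j) x := by
    intro j hj
    rcases hj.lt_or_eq with h | rfl
    · exact hmin j (by simpa using h)
    · rw [hc]
      exact hmin 0 (by simp; omega)
  -- the cycle edge with index `j`, oriented away from `x`
  obtain ⟨E, hE⟩ : ∃ E : ℕ → V × V, ∀ j < 2 * k, G.dist (E j).1 x < G.dist (E j).2 x ∧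
      (E j = (c j, c (j + 1)) ∨ E j = (c (j + 1), c j)) := by
    refine ⟨fun j => if G.dist (c j) x < G.dist (c (j + 1)) x then (c j, c (j + 1)) else
      (c (j + 1), c j), fun j hj => ?_⟩
    have := hb.dist_add_one_eq_or hG (hadj j hj) x
    by_cases h : G.dist (c j) x < G.dist (c (j + 1)) x
    · simp [h]
    · simp only [h, if_false, or_true, and_true]
      omega
  have hceq : ∀ j ≤ 2 * k, ∀ l ≤ 2 * k, c j = c l →
      j = l ∨ (j = 0 ∧ l = 2 * k) ∨ (j = 2 * k ∧ l = 0) := by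
    intro j hj l hl h
    have hI : ∀ a < 2 * k, ∀ b < 2 * k, c a = c b → a = b := fun a ha b hb' hab =>
      hinj (by simpa using ha) (by simpa using hb') hab
    rcases hj.lt_or_eq with h1 | rfl <;> rcases hl.lt_or_eq with h2 | rfl
    · exact Or.inl (hI j h1 l h2 h)
    · rw [hc] at h
      have := hI j h1 0 (by omega) h
      omega
    · rw [hc] at h
      have := hI 0 (by omega) l h2 h
      omega
    · exact Or.inl rfl
  have hEinj : Set.InjOn E (range (2 * k) : Set ℕ) := by
    intro j hj l hl hjl
    simp only [coe_range, Set.mem_Iio] at hj hl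
    rcases (hE j hj).2 with h1 | h1 <;> rcases (hE l hl).2 with h2 | h2 <;>
      rw [h1, h2, Prod.mk.injEq] at hjl
    · have := hceq _ (by omega) _ (by omega) hjl.1
      omega
    · have := hceq _ (by omega) _ (by omega) hjl.1
      have := hceq _ (by omega) _ (by omega) hjl.2
      omega
    · have := hceq _ (by omega) _ (by omega) hjl.1
      have := hceq _ (by omega) _ (by omega) hjl.2
      omega
    · have := hceq _ (by omega) _ (by omega) hjl.2
      omega
  have hEmem : ∀ j < 2 * k, (∃ a ≤ 2 * k, (E j).1 = c a) ∧ (∃ b ≤ 2 * k, (E j).2 = c b) ∧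
      G.Adj (E j).1 (E j).2 := by
    intro j hj
    rcases (hE j hj).2 with h | h <;> rw [h]
    · exact ⟨⟨j, by omega, rfl⟩, ⟨j + 1, by omega, rfl⟩, hadj j hj⟩
    · exact ⟨⟨j + 1, by omega, rfl⟩, ⟨j, by omega, rfl⟩, (hadj j hj).symm⟩
  have hsep : ∀ l < 2 * k, m + ((range (2 * k)).filter fun j => E j ∈ sepDarts G x (c l)).card ≤
      (sepDarts G x (c l)).card := by
    intro l hl
    rw [← card_image_of_injOn (hEinj.mono (by
      exact_mod_cast filter_subset (fun j => E j ∈ sepDarts G x (c l)) (range (2 * k))))]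
    refine add_card_le_card_sepDarts hG ?_ ?_ ?_
    · rw [G.dist_comm]
      exact hmin' l hl.le
    · intro e he
      obtain ⟨j, hj, rfl⟩ := mem_image.1 he
      exact (mem_filter.1 hj).2
    · intro e he
      obtain ⟨j, hj, rfl⟩ := mem_image.1 he
      obtain ⟨⟨a, ha, h⟩, -⟩ := hEmem j (by simpa using (mem_filter.1 hj).1)
      rw [h]
      exact hmin' a ha
  have hcount : ((range (2 * k)).filter fun j => E j ∈ sepDarts G x (c i)).card +
      ((range (2 * k)).filter fun j => E j ∈ sepDarts G x (c (i + k))).card = 2 * k := by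
    -- the distances of either end of a cycle edge to the two antipodal vertices add up to `k`, so
    -- the end closer to one of these vertices is farther from the other
    have hcongr : ((range (2 * k)).filter fun j => E j ∈ sepDarts G x (c (i + k))) =
        (range (2 * k)).filter fun j => ¬ E j ∈ sepDarts G x (c i) := by
      refine filter_congr fun j hj => ?_
      have hj' : j < 2 * k := by simpa using hj
      obtain ⟨⟨a, ha, ea⟩, ⟨b, hb', eb⟩, hab⟩ := hEmem j hj'
      have hx := (hE j hj').1
      have h1 := hb.dist_add_one_eq_or hG hab (c i)
      simp only [mem_sepDarts, hab, hx, true_and]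
      rw [ea, eb] at h1 ⊢
      have h2 := hanti a ha i hi
      have h3 := hanti b hb' i hi
      omega
    rw [hcongr, Finset.card_filter_add_card_filter_not, card_range]
  have h1 := hsep i (by omega)
  have h2 := hsep (i + k) (by omega)
  have h3 := hG.dist_triangle (u := x) (v := c i₀) (w := c i)
  have h4 := hG.dist_triangle (u := x) (v := c i₀) (w := c (i + k))
  have h5 := hanti i₀ hi₀'.le i hi
  rw [G.dist_comm (u := x) (v := c i₀), ← hm] at h3 h4
  unfold excess
  omega

theorem four_mul_card_sub_le [Fintype V] (hG : G.Connected) (hb : G.IsBipartite)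
    (hm : Fintype.card V ≤ G.edgeSet.ncard) :
    (szegedIndex G : ℤ) - (wienerIndex G : ℤ) ≥ 4 * (Fintype.card V : ℤ) - 8 := by
  classical
  obtain ⟨k, c, hk, hc, hinj, hadj, hanti⟩ := exists_isometric_cycle hG hb hm
  set S := (range (2 * k)).image c with hS
  have hScard : S.card = 2 * k := by rw [hS, card_image_of_injOn hinj, card_range]
  have hrow : ∀ x, k * k ≤ ∑ y ∈ S, excess G x y := by
    intro x
    rw [hS, sum_image hinj, two_mul, sum_range_add, ← sum_add_distrib]
    calc k * k = ∑ _i ∈ range k, k := by simp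
      _ ≤ _ := sum_le_sum fun i hi => by
        rw [add_comm k i]
        exact le_excess_add_excess hG hb hk hc hinj hadj hanti x (by simpa using hi)
  have h1 : Fintype.card V * (k * k) ≤ ∑ x, ∑ y ∈ S, excess G x y := by
    calc Fintype.card V * (k * k) = ∑ _x : V, k * k := by simp
      _ ≤ _ := sum_le_sum fun x _ => hrow x
  have h2 : Sᶜ.card * (k * k) ≤ ∑ x, ∑ y ∈ Sᶜ, excess G x y := by
    rw [sum_comm]
    calc Sᶜ.card * (k * k) = ∑ _y ∈ Sᶜ, k * k := by simp
      _ ≤ ∑ y ∈ Sᶜ, ∑ x ∈ S, excess G y x := sum_le_sum fun y _ => hrow y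
      _ ≤ ∑ y ∈ Sᶜ, ∑ x, excess G x y := sum_le_sum fun y _ => by
        rw [sum_congr rfl fun x _ => excess_comm y x]
        exact sum_le_sum_of_subset (subset_univ _)
  have h3 : ∑ x, ∑ y, excess G x y =
      ∑ x, ∑ y ∈ S, excess G x y + ∑ x, ∑ y ∈ Sᶜ, excess G x y := by
    rw [← sum_add_distrib]
    exact sum_congr rfl fun x _ => (sum_add_sum_compl S _).symm
  have h4 := two_mul_szegedIndex_eq hG
  have h5 : Sᶜ.card + 2 * k = Fintype.card V := by
    rw [← hScard, add_comm, card_add_card_compl]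
  -- with `k = l + 2` and `t` vertices off the cycle, the claim is
  -- `8 * (t + 2 * k) - 16 ≤ (t + 2 * k) * k ^ 2 + t * k ^ 2`
  obtain ⟨l, rfl⟩ := Nat.exists_eq_add_of_le hk
  rw [← h5] at h1 ⊢
  zify at *
  have ht : (0 : ℤ) ≤ (Sᶜ.card : ℤ) := Int.natCast_nonneg _
  generalize (Sᶜ.card : ℤ) = t at *
  nlinarith [mul_nonneg ht (Int.natCast_nonneg l), mul_nonneg ht (sq_nonneg (l : ℤ)),
    Int.natCast_nonneg l, pow_nonneg (Int.natCast_nonneg l) 3, sq_nonneg (l : ℤ)]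

/-! ### Distances and separating edges in trees and in the 4-cycle -/

theorem SimpleGraph.IsTree.eq_of_dist_add_one {U : Type v} {T : SimpleGraph U} (hT : T.IsTree)
    {a b u w : U} (hu : T.Adj u b) (hw : T.Adj w b) (hau : T.dist a u + 1 = T.dist a b)
    (haw : T.dist a w + 1 = T.dist a b) : u = w := by
  obtain ⟨p, hp⟩ := hT.connected.exists_walk_length_eq_dist a u
  obtain ⟨q, hq⟩ := hT.connected.exists_walk_length_eq_dist a w
  have h1 : (p.concat hu).IsPath :=
    SimpleGraph.Walk.isPath_of_length_eq_dist _ (by rw [SimpleGraph.Walk.length_concat, hp, hau])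
  have h2 : (q.concat hw).IsPath :=
    SimpleGraph.Walk.isPath_of_length_eq_dist _ (by rw [SimpleGraph.Walk.length_concat, hq, haw])
  have h3 := (hT.existsUnique_path a b).unique h1 h2
  rw [← p.penultimate_concat hu, h3, q.penultimate_concat hw]

/-- In a tree the only edge between the two sides of an edge `uv` is `uv` itself. -/
theorem SimpleGraph.IsTree.eq_of_adj_of_dist_lt {U : Type v} {T : SimpleGraph U} (hT : T.IsTree)
    {u v x y : U} (huv : T.Adj u v) (hxy : T.Adj x y) (hx : T.dist u x < T.dist v x)
    (hy : T.dist v y < T.dist u y) : x = u ∧ y = v := by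
  have h1 := hT.isBipartite.dist_add_one_eq_or hT.connected huv x
  have h2 := hT.isBipartite.dist_add_one_eq_or hT.connected huv y
  have h3 := hT.isBipartite.dist_add_one_eq_or hT.connected hxy u
  have h4 := hT.isBipartite.dist_add_one_eq_or hT.connected hxy v
  rw [T.dist_comm (u := x), T.dist_comm (u := y)] at h3 h4
  rcases Nat.eq_zero_or_pos (T.dist u x) with h0 | h0
  · have h5 : T.dist v y = 0 := by omega
    rw [hT.connected.dist_eq_zero_iff] at h0 h5
    exact ⟨h0.symm, h5.symm⟩
  -- otherwise `v` has two neighbours closer to `x`: the vertex `u` and the next one towards `y`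
  · exfalso
    obtain ⟨p, hp⟩ := hT.connected.exists_walk_length_eq_dist v y
    cases p with
    | nil =>
      rw [SimpleGraph.dist_self] at h4
      omega
    | cons hadj q =>
      rename_i w
      rw [SimpleGraph.Walk.length_cons] at hp
      have h5 := T.dist_le q
      have h6 := hT.connected.dist_triangle (u := x) (v := y) (w := w)
      have h7 : T.dist x y = 1 := SimpleGraph.dist_eq_one_iff_adj.2 hxy
      have h8 := hT.isBipartite.dist_add_one_eq_or hT.connected hadj x
      have h9 : u = w := by
        refine hT.eq_of_dist_add_one (a := x) huv hadj.symm ?_ ?_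
        · simp only [T.dist_comm (u := x)]
          omega
        · rw [h7, T.dist_comm (u := y)] at h6
          simp only [T.dist_comm (u := x)] at h6 ⊢
          omega
      subst h9
      omega

/-- In a tree the separating edges are the edges of the path. -/
theorem SimpleGraph.IsTree.card_sepDarts {U : Type v} [Fintype U] {T : SimpleGraph U}
    (hT : T.IsTree) (x y : U) : (sepDarts T x y).card = T.dist x y := by
  classical
  refine le_antisymm ?_ (dist_le_card_sepDarts hT.connected x y)
  obtain ⟨p, hp⟩ := hT.connected.exists_walk_length_eq_dist x y
  have hsub : sepDarts T x y ⊆ (p.darts.map fun d => d.toProd).toFinset := by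
    intro e he
    obtain ⟨hadj, hx, hy⟩ := mem_sepDarts.1 he
    obtain ⟨d, hd, h1, h2⟩ := p.exists_boundary_dart {z | T.dist e.1 z < T.dist e.2 z} hx hy.not_gt
    have h3 := hT.isBipartite.dist_ne_of_adj hT.connected hadj d.snd
    have h4 : T.dist e.2 d.snd < T.dist e.1 d.snd := by
      have : ¬ T.dist e.1 d.snd < T.dist e.2 d.snd := h2
      omega
    obtain ⟨h5, h6⟩ := hT.eq_of_adj_of_dist_lt hadj d.adj h1 h4
    rw [List.mem_toFinset, List.mem_map]
    exact ⟨d, hd, Prod.ext h5 h6⟩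
  calc (sepDarts T x y).card ≤ (p.darts.map fun d => d.toProd).toFinset.card := card_le_card hsub
    _ ≤ (p.darts.map fun d => d.toProd).length := List.toFinset_card_le _
    _ = T.dist x y := by rw [List.length_map, SimpleGraph.Walk.length_darts, hp]

theorem dist_cycleGraph_four (i j : Fin 4) : (SimpleGraph.cycleGraph 4).dist i j =
    if i = j then 0 else if (SimpleGraph.cycleGraph 4).Adj i j then 1 else 2 := by
  have hconn : (SimpleGraph.cycleGraph 4).Connected := SimpleGraph.cycleGraph_connected
  split_ifs with h1 h2
  · rw [h1, SimpleGraph.dist_self]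
  · exact SimpleGraph.dist_eq_one_iff_adj.2 h2
  · have h3 := hconn.one_lt_dist_of_ne_of_not_adj h1 h2
    obtain ⟨l, h4, h5⟩ : ∃ l, (SimpleGraph.cycleGraph 4).Adj i l ∧
        (SimpleGraph.cycleGraph 4).Adj l j := by
      clear h3
      revert i j
      decide
    have h6 := hconn.dist_triangle (u := i) (v := l) (w := j)
    rw [SimpleGraph.dist_eq_one_iff_adj.2 h4, SimpleGraph.dist_eq_one_iff_adj.2 h5] at h6
    omega

theorem card_sepDarts_cycleGraph_four (i j : Fin 4) :
    (sepDarts (SimpleGraph.cycleGraph 4) i j).card =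
      2 * (SimpleGraph.cycleGraph 4).dist i j := by
  have h : sepDarts (SimpleGraph.cycleGraph 4) i j = univ.filter fun e : Fin 4 × Fin 4 =>
      (SimpleGraph.cycleGraph 4).Adj e.1 e.2 ∧
      (if e.1 = i then 0 else if (SimpleGraph.cycleGraph 4).Adj e.1 i then 1 else 2) <
        (if e.2 = i then 0 else if (SimpleGraph.cycleGraph 4).Adj e.2 i then 1 else 2) ∧
      (if e.2 = j then 0 else if (SimpleGraph.cycleGraph 4).Adj e.2 j then 1 else 2) <
        (if e.1 = j then 0 else if (SimpleGraph.cycleGraph 4).Adj e.1 j then 1 else 2) := by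
    ext e
    simp only [mem_sepDarts, dist_cycleGraph_four, mem_filter, mem_univ, true_and]
  rw [h, dist_cycleGraph_four]
  clear h
  revert i j
  decide

theorem sum_dist_cycleGraph_four (i : Fin 4) :
    ∑ j, (SimpleGraph.cycleGraph 4).dist i j = 4 := by
  simp only [dist_cycleGraph_four]
  revert i
  decide

/-! ### A 4-cycle and a tree glued at a vertex -/

/-- Coordinates on a graph `G` that is composed of a 4-cycle and the graph `T`, glued along the
vertex `r` of `T`. They place `G` inside the Cartesian product of the 4-cycle and `T`: `cyc` and
`tree` embed the two parts, and `toCyc` and `toTree` are the two projections, each collapsing the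
other part to the common vertex. -/
structure C4Gluing {U : Type v} (G : SimpleGraph V) (T : SimpleGraph U) (r : U) where
  /-- The vertex of the 4-cycle that is common to both parts. -/
  base : Fin 4
  /-- The embedding of the 4-cycle. -/
  cyc : Fin 4 → V
  /-- The embedding of `T`. -/
  tree : U → V
  /-- The projection to the 4-cycle. -/
  toCyc : V → Fin 4
  /-- The projection to `T`. -/
  toTree : V → U
  cyc_base : cyc base = tree r
  toCyc_cyc (i : Fin 4) : toCyc (cyc i) = i
  toTree_cyc (i : Fin 4) : toTree (cyc i) = r
  toCyc_tree (a : U) : toCyc (tree a) = base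
  toTree_tree (a : U) : toTree (tree a) = a
  cyc_or_tree (x : V) : cyc (toCyc x) = x ∧ toTree x = r ∨ tree (toTree x) = x ∧ toCyc x = base
  adj_iff (x y : V) : G.Adj x y ↔
    (SimpleGraph.cycleGraph 4).Adj (toCyc x) (toCyc y) ∧ toTree x = toTree y ∨
      T.Adj (toTree x) (toTree y) ∧ toCyc x = toCyc y

namespace C4Gluing

variable {U : Type v} {T : SimpleGraph U} {r : U}

theorem cyc_injective (g : C4Gluing G T r) : Function.Injective g.cyc :=
  Function.LeftInverse.injective g.toCyc_cyc

theorem tree_injective (g : C4Gluing G T r) : Function.Injective g.tree :=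
  Function.LeftInverse.injective g.toTree_tree

theorem sum_eq [Fintype V] [Fintype U] [DecidableEq U] (g : C4Gluing G T r) (f : V → ℕ) :
    ∑ x, f x = ∑ i, f (g.cyc i) + ∑ a ∈ univ.erase r, f (g.tree a) := by
  classical
  have huniv : (univ : Finset V) = univ.image g.cyc ∪ (univ.erase r).image g.tree := by
    ext x
    simp only [mem_univ, true_iff, mem_union, mem_image, mem_erase, and_true, true_and]
    rcases g.cyc_or_tree x with ⟨h, -⟩ | ⟨h, h'⟩
    · exact Or.inl ⟨_, h⟩
    · by_cases hr : g.toTree x = r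
      · exact Or.inl ⟨g.base, g.cyc_base.trans ((congrArg g.tree hr.symm).trans h)⟩
      · exact Or.inr ⟨_, hr, h⟩
  have hdisj : Disjoint (univ.image g.cyc) ((univ.erase r).image g.tree) := by
    rw [Finset.disjoint_left]
    intro x hx hx'
    obtain ⟨i, -, rfl⟩ := mem_image.1 hx
    obtain ⟨a, ha, h⟩ := mem_image.1 hx'
    have := congrArg g.toTree h
    rw [g.toTree_tree, g.toTree_cyc] at this
    exact (mem_erase.1 ha).1 this
  rw [huniv, sum_union hdisj, sum_image g.cyc_injective.injOn, sum_image g.tree_injective.injOn]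

theorem card_eq [Fintype V] [Fintype U] (g : C4Gluing G T r) :
    Fintype.card V = Fintype.card U + 3 := by
  classical
  have h := g.sum_eq fun _ => 1
  have hpos : 0 < Fintype.card U := Fintype.card_pos_iff.2 ⟨r⟩
  simp only [sum_const, smul_eq_mul, mul_one, card_univ, Fintype.card_fin,
    card_erase_of_mem (mem_univ r)] at h
  omega

theorem adj_cyc_iff (g : C4Gluing G T r) (i j : Fin 4) :
    G.Adj (g.cyc i) (g.cyc j) ↔ (SimpleGraph.cycleGraph 4).Adj i j := by
  simp [g.adj_iff, g.toCyc_cyc, g.toTree_cyc]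

theorem adj_tree_iff (g : C4Gluing G T r) (a b : U) :
    G.Adj (g.tree a) (g.tree b) ↔ T.Adj a b := by
  simp [g.adj_iff, g.toCyc_tree, g.toTree_tree]

/-- Every edge of `G` lies in one of the two parts. -/
theorem exists_of_adj (g : C4Gluing G T r) {x y : V} (hadj : G.Adj x y) :
    (∃ i j, (SimpleGraph.cycleGraph 4).Adj i j ∧ g.cyc i = x ∧ g.cyc j = y) ∨
      ∃ a b, T.Adj a b ∧ g.tree a = x ∧ g.tree b = y := by
  have hbase : ∀ z, g.toTree z = r → g.tree (g.toTree z) = z → g.cyc g.base = z := fun z h h' =>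
    g.cyc_base.trans ((congrArg g.tree h.symm).trans h')
  rcases (g.adj_iff x y).1 hadj with ⟨h, h'⟩ | ⟨h, h'⟩
  · left
    refine ⟨_, _, h, ?_⟩
    rcases g.cyc_or_tree x with ⟨hx, hx'⟩ | ⟨hx, hx'⟩ <;>
      rcases g.cyc_or_tree y with ⟨hy, hy'⟩ | ⟨hy, hy'⟩
    · exact ⟨hx, hy⟩
    · exact ⟨hx, by rw [hy', hbase y (h'.symm.trans hx') hy]⟩
    · exact ⟨by rw [hx', hbase x (h'.trans hy') hx], hy⟩
    · exact absurd (hx'.trans hy'.symm) h.ne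
  · right
    refine ⟨_, _, h, ?_⟩
    have hroot : ∀ z, g.toTree z = r → g.cyc (g.toCyc z) = z → g.toCyc z = g.base →
        g.tree (g.toTree z) = z := fun z h1 h2 h3 => by
      rw [h3, g.cyc_base] at h2
      exact (congrArg g.tree h1).trans h2
    rcases g.cyc_or_tree x with ⟨hx, hx'⟩ | ⟨hx, hx'⟩ <;>
      rcases g.cyc_or_tree y with ⟨hy, hy'⟩ | ⟨hy, hy'⟩
    · exact absurd (hx'.trans hy'.symm) h.ne
    · exact ⟨hroot x hx' hx (h'.trans hy'), hy⟩
    · exact ⟨hx, hroot y hy' hy (h'.symm.trans hx')⟩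
    · exact ⟨hx, hy⟩

/-- Two vertices in the same part are joined by a geodesic of that part, and two vertices in
different parts by geodesics to the common vertex. -/
theorem exists_walk (g : C4Gluing G T r) (hT : T.Connected) (x y : V) :
    ∃ p : G.Walk x y, p.length = (SimpleGraph.cycleGraph 4).dist (g.toCyc x) (g.toCyc y) +
      T.dist (g.toTree x) (g.toTree y) := by
  have hC : (SimpleGraph.cycleGraph 4).Connected := SimpleGraph.cycleGraph_connected
  let fc : SimpleGraph.cycleGraph 4 →g G := ⟨g.cyc, fun h => (g.adj_cyc_iff _ _).2 h⟩
  let ft : T →g G := ⟨g.tree, fun h => (g.adj_tree_iff _ _).2 h⟩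
  have hcyc : ∀ i j, ∃ p : G.Walk (g.cyc i) (g.cyc j),
      p.length = (SimpleGraph.cycleGraph 4).dist i j := by
    intro i j
    obtain ⟨p, hp⟩ := hC.exists_walk_length_eq_dist i j
    exact ⟨p.map fc, by rw [SimpleGraph.Walk.length_map, hp]⟩
  have htree : ∀ a b, ∃ p : G.Walk (g.tree a) (g.tree b), p.length = T.dist a b := by
    intro a b
    obtain ⟨p, hp⟩ := hT.exists_walk_length_eq_dist a b
    exact ⟨p.map ft, by rw [SimpleGraph.Walk.length_map, hp]⟩
  have hmixed : ∀ i a, ∃ p : G.Walk (g.cyc i) (g.tree a),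
      p.length = (SimpleGraph.cycleGraph 4).dist i g.base + T.dist r a := by
    intro i a
    obtain ⟨p, hp⟩ := hcyc i g.base
    obtain ⟨q, hq⟩ := htree r a
    exact ⟨(p.copy rfl g.cyc_base).append q, by simp [hp, hq]⟩
  rcases g.cyc_or_tree x with ⟨hx, hx'⟩ | ⟨hx, hx'⟩ <;>
    rcases g.cyc_or_tree y with ⟨hy, hy'⟩ | ⟨hy, hy'⟩
  · obtain ⟨p, hp⟩ := hcyc (g.toCyc x) (g.toCyc y)
    exact ⟨p.copy hx hy, by simp [hp, hx', hy']⟩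
  · obtain ⟨p, hp⟩ := hmixed (g.toCyc x) (g.toTree y)
    exact ⟨p.copy hx hy, by simp [hp, hx', hy']⟩
  · obtain ⟨p, hp⟩ := hmixed (g.toCyc y) (g.toTree x)
    refine ⟨(p.copy hy hx).reverse, ?_⟩
    rw [SimpleGraph.Walk.length_reverse, SimpleGraph.Walk.length_copy, hp, hx', hy',
      SimpleGraph.dist_comm, T.dist_comm]
  · obtain ⟨p, hp⟩ := htree (g.toTree x) (g.toTree y)
    exact ⟨p.copy hx hy, by simp [hp, hx', hy']⟩

theorem connected (g : C4Gluing G T r) (hT : T.Connected) : G.Connected where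
  preconnected x y := ⟨(g.exists_walk hT x y).choose⟩
  nonempty := ⟨g.tree r⟩

/-- The embedding of `G` into the Cartesian product of the 4-cycle and `T` is isometric. -/
theorem dist_eq (g : C4Gluing G T r) (hT : T.Connected) (x y : V) :
    G.dist x y = (SimpleGraph.cycleGraph 4).dist (g.toCyc x) (g.toCyc y) +
      T.dist (g.toTree x) (g.toTree y) := by
  have hC : (SimpleGraph.cycleGraph 4).Connected := SimpleGraph.cycleGraph_connected
  obtain ⟨p, hp⟩ := g.exists_walk hT x y
  refine le_antisymm (hp ▸ G.dist_le p) ?_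
  obtain ⟨q, hq⟩ := (g.connected hT).exists_walk_length_eq_dist x y
  rw [← hq]
  clear hq hp p
  induction q with
  | nil => simp
  | @cons x z y hadj q ih =>
    rw [SimpleGraph.Walk.length_cons]
    have h1 := hC.dist_triangle (u := g.toCyc x) (v := g.toCyc z) (w := g.toCyc y)
    have h2 := hT.dist_triangle (u := g.toTree x) (v := g.toTree z) (w := g.toTree y)
    rcases (g.adj_iff x z).1 hadj with ⟨h, h'⟩ | ⟨h, h'⟩
    · rw [SimpleGraph.dist_eq_one_iff_adj.2 h] at h1
      rw [h'] at h2 ⊢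
      omega
    · rw [SimpleGraph.dist_eq_one_iff_adj.2 h] at h2
      rw [h'] at h1 ⊢
      omega

theorem isBipartite (g : C4Gluing G T r) (hT : T.IsTree) : G.IsBipartite := by
  let colC : Fin 4 → Bool := ![true, false, true, false]
  have hC : ∀ i j, (SimpleGraph.cycleGraph 4).Adj i j → colC i ≠ colC j := by decide
  obtain ⟨cT⟩ := hT.isBipartite
  let colT : T.Coloring Bool := T.recolorOfEquiv finTwoEquiv cT
  let col : G.Coloring Bool := SimpleGraph.Coloring.mk
    (fun x => xor (colC (g.toCyc x)) (colT (g.toTree x))) (by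
      intro x y hadj
      rcases (g.adj_iff x y).1 hadj with ⟨h, h'⟩ | ⟨h, h'⟩
      · have := hC _ _ h
        rw [h']
        simpa using this
      · have := colT.valid h
        rw [h']
        simpa using this)
  exact ⟨G.recolorOfEquiv finTwoEquiv.symm col⟩

/-- The separating edges are those of the cycle that separate the projections to the cycle,
together with those of `T` that separate the projections to `T`. -/
theorem card_sepDarts [Fintype V] [Fintype U] (g : C4Gluing G T r) (hT : T.IsTree) (x y : V) :
    (sepDarts G x y).card = 2 * (SimpleGraph.cycleGraph 4).dist (g.toCyc x) (g.toCyc y) +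
      T.dist (g.toTree x) (g.toTree y) := by
  classical
  have hTc := hT.connected
  have hsep : sepDarts G x y =
      (sepDarts (SimpleGraph.cycleGraph 4) (g.toCyc x) (g.toCyc y)).image (Prod.map g.cyc g.cyc) ∪
      (sepDarts T (g.toTree x) (g.toTree y)).image (Prod.map g.tree g.tree) := by
    ext ⟨a, b⟩
    simp only [mem_union, mem_image, mem_sepDarts, Prod.exists, Prod.map_apply, Prod.mk.injEq]
    constructor
    · rintro ⟨hadj, h1, h2⟩
      rcases g.exists_of_adj hadj with ⟨i, j, h, rfl, rfl⟩ | ⟨i, j, h, rfl, rfl⟩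
      · simp only [g.dist_eq hTc, g.toCyc_cyc, g.toTree_cyc] at h1 h2
        exact Or.inl ⟨i, j, ⟨h, by omega, by omega⟩, rfl, rfl⟩
      · simp only [g.dist_eq hTc, g.toCyc_tree, g.toTree_tree] at h1 h2
        exact Or.inr ⟨i, j, ⟨h, by omega, by omega⟩, rfl, rfl⟩
    · rintro (⟨i, j, ⟨hadj, h1, h2⟩, rfl, rfl⟩ | ⟨i, j, ⟨hadj, h1, h2⟩, rfl, rfl⟩)
      · refine ⟨(g.adj_cyc_iff _ _).2 hadj, ?_, ?_⟩ <;>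
          rw [g.dist_eq hTc, g.dist_eq hTc] <;> simp only [g.toCyc_cyc, g.toTree_cyc] <;> omega
      · refine ⟨(g.adj_tree_iff _ _).2 hadj, ?_, ?_⟩ <;>
          rw [g.dist_eq hTc, g.dist_eq hTc] <;> simp only [g.toCyc_tree, g.toTree_tree] <;> omega
  have hdisj : Disjoint
      ((sepDarts (SimpleGraph.cycleGraph 4) (g.toCyc x) (g.toCyc y)).image (Prod.map g.cyc g.cyc))
      ((sepDarts T (g.toTree x) (g.toTree y)).image (Prod.map g.tree g.tree)) := by
    rw [Finset.disjoint_left]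
    intro e he he'
    obtain ⟨⟨i, j⟩, hij, rfl⟩ := mem_image.1 he
    obtain ⟨⟨a, b⟩, -, hab⟩ := mem_image.1 he'
    simp only [Prod.map_apply, Prod.mk.injEq] at hab
    refine (mem_sepDarts.1 hij).1.ne ?_
    have h1 := congrArg g.toCyc hab.1
    have h2 := congrArg g.toCyc hab.2
    rw [g.toCyc_cyc, g.toCyc_tree] at h1 h2
    exact h1.symm.trans h2
  rw [hsep, card_union_of_disjoint hdisj,
    card_image_of_injective _ (g.cyc_injective.prodMap g.cyc_injective),
    card_image_of_injective _ (g.tree_injective.prodMap g.tree_injective),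
    card_sepDarts_cycleGraph_four, hT.card_sepDarts]

theorem excess_eq [Fintype V] [Fintype U] (g : C4Gluing G T r) (hT : T.IsTree) (x y : V) :
    excess G x y = (SimpleGraph.cycleGraph 4).dist (g.toCyc x) (g.toCyc y) := by
  rw [excess, g.card_sepDarts hT, g.dist_eq hT.connected]
  omega

/-- A gluing is not a tree, since its 4-cycle has pairs of vertices of positive excess. -/
theorem card_le_ncard_edgeSet [Fintype V] [Fintype U] (g : C4Gluing G T r) (hT : T.IsTree) :
    Fintype.card V ≤ G.edgeSet.ncard := by
  by_contra hlt
  have hconn := g.connected hT.connected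
  have h1 := hconn.card_vert_le_card_edgeSet_add_one
  have h2 : Nat.card G.edgeSet = G.edgeSet.ncard := rfl
  have hV : Nat.card V = Fintype.card V := Nat.card_eq_fintype_card
  have htree : G.IsTree := SimpleGraph.isTree_iff_connected_and_card.2 ⟨hconn, by omega⟩
  have h3 := g.excess_eq hT (g.cyc 0) (g.cyc 1)
  rw [excess, htree.card_sepDarts, Nat.sub_self, g.toCyc_cyc, g.toCyc_cyc,
    dist_cycleGraph_four] at h3
  revert h3
  decide

theorem szegedIndex_sub_wienerIndex [Fintype V] [Fintype U] (g : C4Gluing G T r)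
    (hT : T.IsTree) :
    (szegedIndex G : ℤ) - (wienerIndex G : ℤ) = 4 * (Fintype.card V : ℤ) - 8 := by
  classical
  have hcard := g.card_eq
  have hpos : 0 < Fintype.card U := Fintype.card_pos_iff.2 ⟨r⟩
  have hsum : ∀ i, ∑ y, (SimpleGraph.cycleGraph 4).dist i (g.toCyc y) =
      4 + (Fintype.card U - 1) * (SimpleGraph.cycleGraph 4).dist i g.base := by
    intro i
    rw [g.sum_eq fun y => (SimpleGraph.cycleGraph 4).dist i (g.toCyc y)]
    simp only [g.toCyc_cyc, g.toCyc_tree, sum_dist_cycleGraph_four, sum_const, smul_eq_mul,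
      card_erase_of_mem (mem_univ r), card_univ]
  have htotal : ∑ x, ∑ y, excess G x y = 16 + 8 * (Fintype.card U - 1) := by
    simp only [g.excess_eq hT, hsum]
    rw [g.sum_eq fun x => 4 + (Fintype.card U - 1) *
      (SimpleGraph.cycleGraph 4).dist (g.toCyc x) g.base]
    simp only [g.toCyc_cyc, g.toCyc_tree, SimpleGraph.dist_self, sum_add_distrib, ← mul_sum,
      SimpleGraph.dist_comm (v := g.base), sum_dist_cycleGraph_four, sum_const, smul_eq_mul,
      card_erase_of_mem (mem_univ r), card_univ, Fintype.card_fin]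
    omega
  have h := two_mul_szegedIndex_eq (g.connected hT.connected)
  omega

/-- Projecting a vertex outside one of the two subgraphs to the common vertex gives the
coordinates. -/
theorem nonempty_of_isC4SharingVertexWith (h : IsC4SharingVertexWith G T r) :
    Nonempty (C4Gluing G T r) := by
  classical
  obtain ⟨C, B, φ, ⟨ψ⟩, hsup, hint⟩ := h
  have hroot : (φ r : V) ∈ C.verts := by
    have : (φ r : V) ∈ C.verts ∩ B.verts := by rw [hint]; rfl
    exact this.1
  have hboth : ∀ x, x ∈ C.verts → x ∈ B.verts → x = φ r := fun x h1 h2 => by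
    have : x ∈ C.verts ∩ B.verts := ⟨h1, h2⟩
    rwa [hint] at this
  have hmem : ∀ x, x ∈ C.verts ∨ x ∈ B.verts := fun x => by
    have : x ∈ (C ⊔ B).verts := by rw [hsup]; trivial
    simpa using this
  have hadj : ∀ x y, G.Adj x y ↔ C.Adj x y ∨ B.Adj x y := fun x y => by
    rw [← SimpleGraph.Subgraph.sup_adj, hsup, SimpleGraph.Subgraph.top_adj]
  obtain ⟨base, hbase⟩ : ∃ base, ψ base = ⟨φ r, hroot⟩ := ψ.surjective _
  obtain ⟨tc, htc, htc'⟩ : ∃ tc : V → Fin 4, (∀ i, tc (ψ i) = i) ∧ ∀ x ∉ C.verts, tc x = base :=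
    ⟨fun x => if h : x ∈ C.verts then ψ.symm ⟨x, h⟩ else base, fun i => by simp,
      fun x hx => by simp [hx]⟩
  obtain ⟨tt, htt, htt'⟩ : ∃ tt : V → U, (∀ a, tt (φ a) = a) ∧ ∀ x ∉ B.verts, tt x = r :=
    ⟨fun x => if h : x ∈ B.verts then φ.symm ⟨x, h⟩ else r, fun i => by simp,
      fun x hx => by simp [hx]⟩
  have hCr : ∀ x ∈ C.verts, tt x = r := fun x hx => by
    by_cases hB : x ∈ B.verts
    · rw [hboth x hx hB, htt]
    · exact htt' x hB
  have hBb : ∀ x ∈ B.verts, tc x = base := fun x hx => by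
    by_cases hC : x ∈ C.verts
    · rw [hboth x hC hx, ← htc base, hbase]
    · exact htc' x hC
  have hψ : ∀ x ∈ C.verts, (ψ (tc x) : V) = x := fun x hx => by
    obtain ⟨i, hi⟩ := ψ.surjective ⟨x, hx⟩
    have hx' : x = ψ i := by rw [hi]
    rw [hx', htc]
  have hφ : ∀ x ∈ B.verts, (φ (tt x) : V) = x := fun x hx => by
    obtain ⟨i, hi⟩ := φ.surjective ⟨x, hx⟩
    have hx' : x = φ i := by rw [hi]
    rw [hx', htt]
  have hψadj : ∀ i j, C.Adj (ψ i) (ψ j) ↔ (SimpleGraph.cycleGraph 4).Adj i j :=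
    fun i j => ψ.map_adj_iff
  have hφadj : ∀ a b, B.Adj (φ a) (φ b) ↔ T.Adj a b := fun a b => φ.map_adj_iff
  have hCroot : ∀ x ∈ B.verts, tt x = r → x ∈ C.verts := fun x hx hr => by
    rw [← hφ x hx, hr]; exact hroot
  have hBroot : ∀ x ∈ C.verts, tc x = base → x ∈ B.verts := fun x hx hb => by
    rw [← hψ x hx, hb, hbase]; exact (φ r).2
  refine ⟨⟨base, fun i => ψ i, fun a => φ a, tc, tt, by rw [hbase], htc,
    fun i => hCr _ (ψ i).2, fun a => hBb _ (φ a).2, htt, ?_, ?_⟩⟩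
  · intro x
    rcases hmem x with h | h
    · exact Or.inl ⟨hψ x h, hCr x h⟩
    · exact Or.inr ⟨hφ x h, hBb x h⟩
  · intro x y
    rw [hadj]
    constructor
    · rintro (h | h)
      · left
        have hx := h.fst_mem
        have hy := h.snd_mem
        rw [← hψadj, hψ x hx, hψ y hy, hCr x hx, hCr y hy]
        exact ⟨h, rfl⟩
      · right
        have hx := h.fst_mem
        have hy := h.snd_mem
        rw [← hφadj, hφ x hx, hφ y hy, hBb x hx, hBb y hy]
        exact ⟨h, rfl⟩
    · rintro (⟨h, h'⟩ | ⟨h, h'⟩)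
      · left
        have hxy : x ∈ C.verts ∧ y ∈ C.verts := by
          rcases hmem x with hx | hx <;> rcases hmem y with hy | hy
          · exact ⟨hx, hy⟩
          · exact ⟨hx, hCroot y hy (h'.symm.trans (hCr x hx))⟩
          · exact ⟨hCroot x hx (h'.trans (hCr y hy)), hy⟩
          · exact absurd ((hBb x hx).trans (hBb y hy).symm) h.ne
        rwa [← hψadj, hψ x hxy.1, hψ y hxy.2] at h
      · right
        have hxy : x ∈ B.verts ∧ y ∈ B.verts := by
          rcases hmem x with hx | hx <;> rcases hmem y with hy | hy
          · exact absurd ((hCr x hx).trans (hCr y hy).symm) h.ne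
          · exact ⟨hBroot x hx (h'.trans (hBb y hy)), hy⟩
          · exact ⟨hx, hBroot y hy (h'.symm.trans (hBb x hx))⟩
          · exact ⟨hx, hy⟩
        rwa [← hφadj, hφ x hxy.1, hφ y hxy.2] at h

theorem isC4SharingVertexWith (g : C4Gluing G T r) : IsC4SharingVertexWith G T r := by
  let fc : SimpleGraph.Copy (SimpleGraph.cycleGraph 4) G :=
    SimpleGraph.Hom.toCopy ⟨g.cyc, fun h => (g.adj_cyc_iff _ _).2 h⟩ g.cyc_injective
  let ft : SimpleGraph.Copy T G :=
    SimpleGraph.Hom.toCopy ⟨g.tree, fun h => (g.adj_tree_iff _ _).2 h⟩ g.tree_injective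
  refine ⟨fc.toSubgraph, ft.toSubgraph, ft.isoToSubgraph, ⟨fc.isoToSubgraph⟩, ?_, ?_⟩
  · refine eq_top_iff.2 ⟨fun x _ => ?_, fun x y hxy => ?_⟩
    · rcases g.cyc_or_tree x with ⟨h, -⟩ | ⟨h, -⟩
      · exact Or.inl ⟨_, trivial, h⟩
      · exact Or.inr ⟨_, trivial, h⟩
    · rcases g.exists_of_adj hxy with ⟨i, j, h, hi, hj⟩ | ⟨a, b, h, ha, hb⟩
      · exact Or.inl ⟨i, j, h, hi, hj⟩
      · exact Or.inr ⟨a, b, h, ha, hb⟩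
  · have hroot : ((ft.isoToSubgraph r : ft.toSubgraph.verts) : V) = g.tree r := rfl
    rw [hroot]
    ext x
    constructor
    · rintro ⟨⟨i, -, rfl⟩, ⟨a, -, ha⟩⟩
      have h : g.tree a = g.cyc i := ha
      have h1 : a = r := by rw [← g.toTree_tree a, h, g.toTree_cyc]
      exact ha.symm.trans (congrArg g.tree h1)
    · rintro rfl
      exact ⟨⟨g.base, trivial, g.cyc_base⟩, ⟨r, trivial, rfl⟩⟩

/-- The 4-cycle and `T` glued along `r`, on any vertex type that is in bijection with `Fin 3 ⊕ U`:
the three further vertices of the cycle are placed at `(1, r)`, `(2, r)`, `(3, r)` in the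
Cartesian product of the 4-cycle and `T`, and the vertices of `T` at `(0, a)`. -/
theorem exists_of_equiv (T : SimpleGraph U) (r : U) (e : V ≃ Fin 3 ⊕ U) :
    ∃ G : SimpleGraph V, Nonempty (C4Gluing G T r) := by
  let pos : V → Fin 4 × U := fun x => Sum.elim (fun i => (i.succ, r)) (fun a => (0, a)) (e x)
  refine ⟨(SimpleGraph.cycleGraph 4 □ T).comap pos, ⟨{
    base := 0
    cyc := fun i => e.symm (Fin.cases (Sum.inr r) Sum.inl i)
    tree := fun a => e.symm (Sum.inr a)
    toCyc := fun x => (pos x).1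
    toTree := fun x => (pos x).2
    cyc_base := rfl
    toCyc_cyc := fun i => by
      cases i using Fin.cases <;> simp [pos]
    toTree_cyc := fun i => by
      cases i using Fin.cases <;> simp [pos]
    toCyc_tree := fun a => by simp [pos]
    toTree_tree := fun a => by simp [pos]
    cyc_or_tree := fun x => by
      obtain ⟨s, rfl⟩ := e.symm.surjective x
      rcases s with i | a <;> simp [pos]
    adj_iff := fun x y => by
      rw [SimpleGraph.comap_adj, SimpleGraph.boxProd_adj] }⟩⟩

end C4Gluing

theorem exists_isC4SharingVertexWith {n : ℕ} (hn : 4 ≤ n) {U : Type v} [Fintype U]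
    (T : SimpleGraph U) (r : U) (hU : Fintype.card U = n - 3) :
    ∃ G : SimpleGraph (Fin n), IsC4SharingVertexWith G T r := by
  have e : Fin n ≃ Fin 3 ⊕ U := Fintype.equivOfCardEq (by
    rw [Fintype.card_sum, Fintype.card_fin, Fintype.card_fin, hU]
    omega)
  obtain ⟨G, ⟨g⟩⟩ := C4Gluing.exists_of_equiv T r e
  exact ⟨G, g.isC4SharingVertexWith⟩

end

theorem theorem2p2 (n : ℕ) (hn : 4 ≤ n) :
    -- the inequality
    (∀ (V : Type u) [Fintype V] (G : SimpleGraph V), Fintype.card V = n →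
      G.Connected → G.IsBipartite → n ≤ G.edgeSet.ncard →
      (szegedIndex G : ℤ) - (wienerIndex G : ℤ) ≥ 4 * (n : ℤ) - 8) ∧
    -- every 4-cycle sharing a vertex with a tree on `n - 3` vertices attains the bound
    (∀ (U : Type v) [Fintype U] (T : SimpleGraph U) (r : U), T.IsTree → Fintype.card U = n - 3 →
      ∀ (V : Type u) [Fintype V] (G : SimpleGraph V), IsC4SharingVertexWith G T r →
        Fintype.card V = n ∧ G.Connected ∧ G.IsBipartite ∧ n ≤ G.edgeSet.ncard ∧
        (szegedIndex G : ℤ) - (wienerIndex G : ℤ) = 4 * (n : ℤ) - 8) ∧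
    -- such a graph exists for every tree on `n - 3` vertices and every choice of shared vertex
    (∀ (U : Type v) [Fintype U] (T : SimpleGraph U) (r : U), T.IsTree → Fintype.card U = n - 3 →
      ∃ G : SimpleGraph (Fin n), IsC4SharingVertexWith G T r) ∧
    -- in particular the bound is best possible for every `n`
    (∃ G : SimpleGraph (Fin n), G.Connected ∧ G.IsBipartite ∧ n ≤ G.edgeSet.ncard ∧
      (szegedIndex G : ℤ) - (wienerIndex G : ℤ) = 4 * (n : ℤ) - 8) := by
  refine ⟨?_, ?_, ?_, ?_⟩
  · rintro V _ G rfl hG hb hm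
    exact four_mul_card_sub_le hG hb hm
  · intro U _ T r hT hU V _ G h
    obtain ⟨g⟩ := C4Gluing.nonempty_of_isC4SharingVertexWith h
    obtain rfl : Fintype.card V = n := by
      rw [g.card_eq, hU]
      omega
    exact ⟨rfl, g.connected hT.connected, g.isBipartite hT, g.card_le_ncard_edgeSet hT,
      g.szegedIndex_sub_wienerIndex hT⟩
  · intro U _ T r _ hU
    exact exists_isC4SharingVertexWith hn T r hU
  · have : Nonempty (Fin (n - 3)) := ⟨⟨0, by omega⟩⟩
    have hconn : (⊤ : SimpleGraph (Fin (n - 3))).Connected := SimpleGraph.connected_top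
    obtain ⟨T, -, hT⟩ := hconn.exists_isTree_le
    have e : Fin n ≃ Fin 3 ⊕ Fin (n - 3) := Fintype.equivOfCardEq (by
      simp only [Fintype.card_sum, Fintype.card_fin]
      omega)
    obtain ⟨G, ⟨g⟩⟩ := C4Gluing.exists_of_equiv T ⟨0, by omega⟩ e
    have h1 := g.card_le_ncard_edgeSet hT
    have h2 := g.szegedIndex_sub_wienerIndex hT
    rw [Fintype.card_fin] at h1 h2
    exact ⟨G, g.connected hT.connected, g.isBipartite hT, h1, h2⟩
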